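/- Let $\Gamma=\{v_1,\dots,v_n\}$ be a linearly independent set in $\mathbb{R}^n$, let $0<T\le\infty$ and $M>0$, and let $u:\mathbb{R}^n\times[0,T)\to\mathbb{R}$ be a smooth solution (smooth up to and including $t=0$) of the graphical mean curvature flow $$\frac{\partial u}{\partial t}=\sum_{i,j=1}^n\left(\delta_{ij}-\frac{D_iu\,D_ju}{1+|Du|^2}\right)D_iD_ju ,$$ such that $u(\cdot,t)$ is $\Gamma$-periodic for every $t\in[0,T)$, i.e. $u(x+v_i,t)=u(x,t)$ for all $x\in\mathbb{R}^n$ and $1\le i\le n$, and such that $|u(x,0)-u(y,0)|\le M$ for all $x,y\in\mathbb{R}^n$. Let $\varphi$ be the special solution of the graphical curve-shortening flow $$\frac{\partial\varphi}{\partial t}=\frac{\varphi''}{1+(\varphi')^2}$$ with step initial data $\frac12$, that is, the solution which is smooth on $[0,\infty)\times(0,\infty)$, is nondecreasing in $x$, and satisfies $\varphi(0,t)=0$ for $t>0$, $\varphi(x,t)\to\frac12$ as $t\to0^+$ for each $x>0$, and $\varphi(x,t)\to\frac12$ as $x\to\infty$ for each $t>0$. Then for all $x,y\in\mathbb{R}^n$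 and all $t\in(0,T)$, $$|u(y,t)-u(x,t)|\le 2M\,\varphi\left(\frac{|y-x|}{2M},\frac{t}{M^2}\right).$$ Moreover, $1+|Du(x,t)|^2\le\exp\left(\frac{2M^2}{t}\right)$ for all $x\in\mathbb{R}^n$ and all $t\in(0,T)$. -/

import Mathlib

open Filter Topology Set
open scoped ContDiff

/-- The `i`-th partial derivative `D_i f` of a function on `ℝⁿ`. -/
noncomputable def partialDeriv {n : ℕ} (i : Fin n) (f : EuclideanSpace ℝ (Fin n) → ℝ)
    (x : EuclideanSpace ℝ (Fin n)) : ℝ :=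
  fderiv ℝ f x (EuclideanSpace.single i (1 : ℝ))

/-- The graphical mean curvature operator
`∑_{i,j} (δ_ij - D_i f D_j f / (1 + |Df|²)) D_i D_j f`. -/
noncomputable def graphicalMCOperator {n : ℕ} (f : EuclideanSpace ℝ (Fin n) → ℝ)
    (x : EuclideanSpace ℝ (Fin n)) : ℝ :=
  ∑ i : Fin n, ∑ j : Fin n,
    ((if i = j then (1 : ℝ) else 0)
        - partialDeriv i f x * partialDeriv j f x / (1 + ‖gradient f x‖ ^ 2))
      * partialDeriv i (partialDeriv j f) x

/-- `u : ℝⁿ × [0, T) → ℝ` is a smooth solution of graphical mean curvature flow, `T ≤ ∞`.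
Smoothness is up to and including time `0`. The equation is imposed at the times `0 < t < T`;
it extends to `t = 0` by continuity. -/
structure IsSmoothGraphicalMCF {n : ℕ} (T : EReal)
    (u : EuclideanSpace ℝ (Fin n) → ℝ → ℝ) : Prop where
  smooth : ContDiffOn ℝ ∞ (fun p : EuclideanSpace ℝ (Fin n) × ℝ => u p.1 p.2)
    {p | 0 ≤ p.2 ∧ (p.2 : EReal) < T}
  equation : ∀ (x : EuclideanSpace ℝ (Fin n)) (t : ℝ), 0 < t → (t : EReal) < T →
    deriv (fun s => u x s) t = graphicalMCOperator (fun z => u z t) x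

/-- `f` is `Γ`-periodic, where `Γ = {Γ 1, …, Γ n}`. -/
def IsGammaPeriodic {n : ℕ} (Γ : Fin n → EuclideanSpace ℝ (Fin n))
    (f : EuclideanSpace ℝ (Fin n) → ℝ) : Prop :=
  ∀ (x : EuclideanSpace ℝ (Fin n)) (i : Fin n), f (x + Γ i) = f x

/-- `φ` is the special solution of the graphical curve-shortening flow
`φ_t = φ'' / (1 + (φ')²)` on the half-line with zero boundary value and step initial data `1/2`:
it is smooth on `[0, ∞) × (0, ∞)`, nondecreasing in space, vanishes at `x = 0`, and tends to `1/2`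
as `t → 0` for each `x > 0` and as `x → ∞` for each `t > 0`. -/
structure IsStepCurveShortening (φ : ℝ → ℝ → ℝ) : Prop where
  smooth : ContDiffOn ℝ ∞ (fun p : ℝ × ℝ => φ p.1 p.2) (Ici 0 ×ˢ Ioi 0)
  equation : ∀ x t : ℝ, 0 < x → 0 < t →
    deriv (fun s => φ x s) t
      = deriv (deriv (fun z => φ z t)) x / (1 + (deriv (fun z => φ z t) x) ^ 2)
  boundary : ∀ t : ℝ, 0 < t → φ 0 t = 0
  initial : ∀ x : ℝ, 0 < x → Tendsto (fun t => φ x t) (𝓝[>] 0) (𝓝 (1 / 2))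
  atInfinity : ∀ t : ℝ, 0 < t → Tendsto (fun x => φ x t) atTop (𝓝 (1 / 2))
  monotone : ∀ t : ℝ, 0 < t → MonotoneOn (fun x => φ x t) (Ici 0)

/-!
Both estimates come from one comparison principle, `IsStepBarrier.sub_le`, for the two-point function
`u(y, t) - u(x, t) - 2M ψ(|y - x| / 2M, t / M²)`, where `ψ` is a spatially nondecreasing
supersolution of `ψ_τ = ψ'' / (1 + (ψ')²)` on the half-line whose initial values are at least `1/2`
away from the origin.

At a positive spatial maximum of this function with `x ≠ y`, let `e` be the unit vector from `x` to
`y`. The first-order conditions give `Du(x) = Du(y) = ψ' e`, so that the mean curvature operator has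
the same coefficients at both points. Moving both points in the same direction shows that the
quadratic form `H = D²u(y) - D²u(x)` is nonpositive; moving them apart along `e` shows that
`H(e, e) ≤ (2 / M) ψ''`. A form `H ≤ 0` satisfies `tr H ≤ H(e, e)`, and therefore the difference of
the two curvature operators is at most `H(e, e) / (1 + (ψ')²)`, hence at most the time derivative of
the barrier term (`graphicalMCOperator_sub_le`). No concavity of `ψ` enters. Since `ψ` is
nondecreasing, lattice translations bring every pair of points into a fixed compact set without
decreasing the two-point function, so the maximum is attained. The singularity of `ψ` at the space-time
origin is avoided by starting at a small positive time: there, up to an arbitrarily small error, nearby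
points are controlled by the uniform continuity of `u` and distant ones by the oscillation bound.

The special solution `φ` is itself such a barrier, which gives the first estimate. The constant `1/2`
is another, and shows that the oscillation stays below `M`; barriers thus need to be supersolutions
only where they are below `1/2`. The gradient estimate uses the explicit barrier
`sinh (λ ψ) = C sin (λ x)`, continued by a constant beyond `λ x = π / 2`. For constant `λ` and
`C' = -λ² C` this is an exact solution. It remains a supersolution when `λ' ≤ 0` and `C' ≥ -λ² C`,
because `θ cos θ ≤ sin θ` and `sinh w ≤ w cosh w`, and it dominates the step data when `λ → ∞` as
`τ → 0` and `sinh (λ / 2) ≤ C`. These conditions are compatible with `1 + C² = exp (2 / τ)`, and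
`ψ(x, τ) ≤ C(τ) x` turns the two-point estimate into the gradient bound.
-/

/-! ### Derivative tests on the line -/

theorem nonpos_of_isLocalMax_of_hasDerivAt_hasDerivAt {g g' : ℝ → ℝ} {a c : ℝ}
    (hmax : IsLocalMax g a) (hg : ∀ᶠ s in 𝓝 a, HasDerivAt g (g' s) s)
    (hg' : HasDerivAt g' c a) : c ≤ 0 := by
  by_contra! hc
  have h1 : deriv g =ᶠ[𝓝 a] g' := hg.mono fun s hs => hs.deriv
  have h2 : deriv (deriv g) a = c := by rw [h1.deriv_eq, hg'.deriv]
  have hmin : IsLocalMin g a :=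
    isLocalMin_of_deriv_deriv_pos (h2 ▸ hc) hmax.deriv_eq_zero hg.self_of_nhds.continuousAt
  have h3 : g =ᶠ[𝓝 a] fun _ => g a := by
    filter_upwards [hmax, hmin] with s h h' using le_antisymm h h'
  have h4 : deriv g =ᶠ[𝓝 a] fun _ => 0 := by
    simpa using h3.deriv
  have h5 := h4.deriv_eq
  simp [h2] at h5
  exact hc.ne' h5

/-- One-sided first derivative test; it also covers a maximum at the right end of a time interval. -/
theorem HasDerivAt.nonneg_of_eventually_le_left {h : ℝ → ℝ} {c t : ℝ} (hd : HasDerivAt h c t)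
    (hle : ∀ᶠ s in 𝓝[<] t, h s ≤ h t) : 0 ≤ c := by
  have h1 : Tendsto (slope h t) (𝓝[<] t) (𝓝 c) :=
    (hasDerivAt_iff_tendsto_slope.1 hd).mono_left
      (nhdsWithin_mono _ fun s (hs : s < t) => hs.ne)
  refine ge_of_tendsto h1 ?_
  filter_upwards [hle, self_mem_nhdsWithin] with s hs (hst : s < t)
  rw [slope_def_field]
  exact div_nonneg_of_nonpos (by linarith) (by linarith)

/-! ### Two-point maxima -/

section TwoPoint

variable {E : Type*} [NormedAddCommGroup E] [InnerProductSpace ℝ E]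

theorem hasDerivAt_norm_add_smul {w : E} (hw : w ≠ 0) (v : E) :
    HasDerivAt (fun s : ℝ => ‖w + s • v‖) (inner ℝ (‖w‖⁻¹ • w) v) 0 := by
  have h1 : HasDerivAt (fun s : ℝ => w + s • v) v 0 := by
    simpa using ((hasDerivAt_id (0 : ℝ)).smul_const v).const_add w
  have h2 := h1.norm_sq
  have h3 := h2.sqrt (by simpa using hw)
  have hw' : ‖w‖ ≠ 0 := norm_ne_zero_iff.2 hw
  convert h3 using 1
  · ext s; simp
  · simp [real_inner_smul_left]
    field_simp

theorem hasDerivAt_comp_line {f : E → ℝ} (hf : ContDiff ℝ 2 f) (x v : E) (s : ℝ) :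
    HasDerivAt (fun s : ℝ => f (x + s • v)) (fderiv ℝ f (x + s • v) v) s := by
  have h1 : HasDerivAt (fun s : ℝ => x + s • v) v s := by
    simpa using ((hasDerivAt_id s).smul_const v).const_add x
  exact ((hf.differentiable (by norm_num)) _).hasFDerivAt.comp_hasDerivAt s h1

theorem hasDerivAt_fderiv_comp_line {f : E → ℝ} (hf : ContDiff ℝ 2 f) (x v : E) :
    HasDerivAt (fun s : ℝ => fderiv ℝ f (x + s • v) v) (fderiv ℝ (fderiv ℝ f) x v v) 0 := by
  have h1 : HasDerivAt (fun s : ℝ => x + s • v) v 0 := by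
    simpa using ((hasDerivAt_id (0 : ℝ)).smul_const v).const_add x
  have hd : Differentiable ℝ (fderiv ℝ f) :=
    (hf.fderiv_right (m := 1) (by norm_num)).differentiable (by norm_num)
  have h2 := (hd (x + (0 : ℝ) • v)).hasFDerivAt.comp_hasDerivAt 0 h1
  have h3 := h2.clm_apply (hasDerivAt_const (0 : ℝ) v)
  simpa using h3

/-- First- and second-order conditions at a maximum of `(x, y) ↦ f y - f x - 2M ψ(|y - x| / 2M)` off the
diagonal. The vector `e` is the unit vector from `x` to `y`, and `p`, `q` are the first derivative
function and the second derivative of `ψ` at `|y - x| / 2M`. -/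
theorem exists_unit_of_twoPoint_max {f : E → ℝ} (hf : ContDiff ℝ 2 f) {M : ℝ} (hM : 0 < M) {x y : E}
    (hxy : x ≠ y) {ψ p : ℝ → ℝ} {q : ℝ}
    (hψ : ∀ᶠ z in 𝓝 (‖y - x‖ / (2 * M)), HasDerivAt ψ (p z) z)
    (hp : HasDerivAt p q (‖y - x‖ / (2 * M)))
    (hmax : ∀ x' y' : E, f y' - f x' - 2 * M * ψ (‖y' - x'‖ / (2 * M)) ≤
      f y - f x - 2 * M * ψ (‖y - x‖ / (2 * M))) :
    ∃ e : E, ‖e‖ = 1 ∧ (∀ v, fderiv ℝ f y v = p (‖y - x‖ / (2 * M)) * inner ℝ e v) ∧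
      fderiv ℝ f x = fderiv ℝ f y ∧
      (∀ v, fderiv ℝ (fderiv ℝ f) y v v ≤ fderiv ℝ (fderiv ℝ f) x v v) ∧
      fderiv ℝ (fderiv ℝ f) y e e - fderiv ℝ (fderiv ℝ f) x e e ≤ 2 / M * q := by
  have hw : y - x ≠ 0 := sub_ne_zero.2 hxy.symm
  have hw' : 0 < ‖y - x‖ := norm_pos_iff.2 hw
  -- Translating both points leaves their distance unchanged.
  have htrans : ∀ v : E, IsLocalMax (fun s : ℝ => f (y + s • v) - f (x + s • v)) 0 := by
    intro v
    refine Eventually.of_forall fun s => ?_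
    have := hmax (x + s • v) (y + s • v)
    simp only [add_sub_add_right_eq_sub] at this
    simp only [zero_smul, add_zero]
    linarith
  refine ⟨‖y - x‖⁻¹ • (y - x), ?_, ?_, ?_, ?_, ?_⟩
  · rw [norm_smul, norm_inv, norm_norm, inv_mul_cancel₀ hw'.ne']
  · intro v
    have hloc : IsLocalMax
        (fun s : ℝ => f (y + s • v) - 2 * M * ψ (‖(y - x) + s • v‖ / (2 * M))) 0 := by
      refine Eventually.of_forall fun s => ?_
      have := hmax x (y + s • v)
      rw [add_sub_right_comm] at this
      simp only [zero_smul, add_zero]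
      linarith
    have h1 := ((hasDerivAt_norm_add_smul hw v).div_const (2 * M))
    have h2 : HasDerivAt ψ (p (‖y - x‖ / (2 * M))) (‖(y - x) + (0 : ℝ) • v‖ / (2 * M)) := by
      simpa using hψ.self_of_nhds
    have h3 := (hasDerivAt_comp_line hf y v 0).sub ((h2.comp 0 h1).const_mul (2 * M))
    have h4 := hloc.hasDerivAt_eq_zero h3
    simp only [zero_smul, add_zero] at h4
    have h5 : ∀ a k : ℝ, 2 * M * (a * (k / (2 * M))) = a * k := fun a k => by field_simp
    rw [h5] at h4
    linarith
  · ext v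
    have h3 := (hasDerivAt_comp_line hf y v 0).sub (hasDerivAt_comp_line hf x v 0)
    have h4 := (htrans v).hasDerivAt_eq_zero h3
    simp only [zero_smul, add_zero] at h4
    linarith
  · intro v
    have := nonpos_of_isLocalMax_of_hasDerivAt_hasDerivAt (htrans v)
      (Eventually.of_forall fun s =>
        (hasDerivAt_comp_line hf y v s).sub (hasDerivAt_comp_line hf x v s))
      ((hasDerivAt_fderiv_comp_line hf y v).sub (hasDerivAt_fderiv_comp_line hf x v))
    linarith
  · set e := ‖y - x‖⁻¹ • (y - x) with he
    have hed : y - x = ‖y - x‖ • e := by rw [he, smul_inv_smul₀ hw'.ne']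
    have hen : ‖e‖ = 1 := by
      rw [he, norm_smul, norm_inv, norm_norm, inv_mul_cancel₀ hw'.ne']
    -- Moving the points apart at speed `2` along the segment that joins them.
    have hdist : ∀ᶠ s : ℝ in 𝓝 0, ‖(y + s • e) - (x + s • (-e))‖ / (2 * M) =
        ‖y - x‖ / (2 * M) + s / M := by
      filter_upwards [lt_mem_nhds (show -(‖y - x‖ / 2) < 0 by linarith)] with s hs
      have : (y + s • e) - (x + s • (-e)) = (‖y - x‖ + 2 * s) • e := by
        rw [add_smul, ← hed, two_mul, add_smul, smul_neg]; abel
      rw [this, norm_smul, hen, Real.norm_of_nonneg (by linarith)]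
      field_simp
    have hloc : IsLocalMax (fun s : ℝ => f (y + s • e) - f (x + s • (-e)) -
        2 * M * ψ (‖y - x‖ / (2 * M) + s / M)) 0 := by
      filter_upwards [hdist] with s hs
      have := hmax (x + s • (-e)) (y + s • e)
      rw [hs] at this
      simpa using this
    have hlin : ∀ s : ℝ, HasDerivAt (fun s => ‖y - x‖ / (2 * M) + s / M) (1 / M) s :=
      fun s => ((hasDerivAt_id s).div_const M).const_add _
    have hlim : Tendsto (fun s => ‖y - x‖ / (2 * M) + s / M) (𝓝 0)
        (𝓝 (‖y - x‖ / (2 * M))) := by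
      simpa using (hlin 0).continuousAt.tendsto
    have hψ' : ∀ᶠ s : ℝ in 𝓝 0, HasDerivAt
        (fun s => ψ (‖y - x‖ / (2 * M) + s / M))
          (p (‖y - x‖ / (2 * M) + s / M) * (1 / M)) s := by
      filter_upwards [hlim.eventually hψ] with s hs using hs.comp s (hlin s)
    have hp' : HasDerivAt (fun s => p (‖y - x‖ / (2 * M) + s / M)) (q * (1 / M)) 0 := by
      refine HasDerivAt.comp (h := fun s => ‖y - x‖ / (2 * M) + s / M) 0 ?_ (hlin 0)
      simpa using hp
    have := nonpos_of_isLocalMax_of_hasDerivAt_hasDerivAt hloc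
      (hψ'.mono fun s hs => ((hasDerivAt_comp_line hf y e s).sub
        (hasDerivAt_comp_line hf x (-e) s)).sub (hs.const_mul (2 * M)))
      (((hasDerivAt_fderiv_comp_line hf y e).sub (hasDerivAt_fderiv_comp_line hf x (-e))).sub
        ((hp'.mul_const (1 / M)).const_mul (2 * M)))
    simp only [map_neg, neg_apply, neg_neg] at this
    have h2 : 2 * M * (q * (1 / M) * (1 / M)) = 2 / M * q := by field_simp
    linarith

end TwoPoint

/-! ### The mean curvature operator at a two-point maximum -/

/-- The coordinate-free form `tr D²f - D²f(∇f, ∇f) / (1 + |∇f|²)` of the operator. -/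
theorem graphicalMCOperator_eq {n : ℕ} {f : EuclideanSpace ℝ (Fin n) → ℝ} (hf : ContDiff ℝ 2 f)
    (x : EuclideanSpace ℝ (Fin n)) :
    graphicalMCOperator f x =
      (∑ i, fderiv ℝ (fderiv ℝ f) x (EuclideanSpace.single i 1) (EuclideanSpace.single i 1)) -
        fderiv ℝ (fderiv ℝ f) x (gradient f x) (gradient f x) / (1 + ‖gradient f x‖ ^ 2) := by
  have hd : Differentiable ℝ (fderiv ℝ f) :=
    (hf.fderiv_right (m := 1) (by norm_num)).differentiable (by norm_num)
  have h2 : ∀ i j, partialDeriv i (partialDeriv j f) x =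
      fderiv ℝ (fderiv ℝ f) x (EuclideanSpace.single i 1) (EuclideanSpace.single j 1) := by
    intro i j
    have := ((hd x).hasFDerivAt.clm_apply
      (hasFDerivAt_const (EuclideanSpace.single j (1 : ℝ)) x)).fderiv
    unfold partialDeriv
    rw [this]
    simp
  have hp : ∀ i, partialDeriv i f x = gradient f x i := by
    intro i
    unfold partialDeriv
    rw [← inner_gradient_left, EuclideanSpace.inner_single_right]
    simp
  have hsum : gradient f x = ∑ i, gradient f x i • EuclideanSpace.single i (1 : ℝ) := by
    simpa using ((EuclideanSpace.basisFun (Fin n) ℝ).sum_repr (gradient f x)).symm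
  have hq : fderiv ℝ (fderiv ℝ f) x (gradient f x) (gradient f x) =
      ∑ i, ∑ j, gradient f x i * gradient f x j *
        fderiv ℝ (fderiv ℝ f) x (EuclideanSpace.single i 1) (EuclideanSpace.single j 1) := by
    conv_lhs => rw [hsum]
    simp only [map_sum, map_smul, sum_apply, smul_apply,
      smul_eq_mul, Finset.mul_sum]
    rw [Finset.sum_comm]
    refine Finset.sum_congr rfl fun i _ => Finset.sum_congr rfl fun j _ => by ring
  unfold graphicalMCOperator
  rw [hq, Finset.sum_div, ← Finset.sum_sub_distrib]
  refine Finset.sum_congr rfl fun i _ => ?_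
  simp only [sub_mul, Finset.sum_sub_distrib, h2, hp, Finset.sum_div, ite_mul, one_mul, zero_mul,
    Finset.sum_ite_eq, Finset.mem_univ, if_true]
  congr 1
  refine Finset.sum_congr rfl fun j _ => by ring

/-- The trace of a nonpositive form is at most its value on any unit vector: the difference is the trace
of the form restricted to the orthogonal complement, computed here by summing over the projections
`eᵢ - ⟪eᵢ, e⟫ e` of the standard basis. -/
theorem sum_apply_single_le {n : ℕ}
    {B : EuclideanSpace ℝ (Fin n) →L[ℝ] EuclideanSpace ℝ (Fin n) →L[ℝ] ℝ}
    (hB : ∀ v, B v v ≤ 0) {e : EuclideanSpace ℝ (Fin n)} (he : ‖e‖ = 1) :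
    ∑ i, B (EuclideanSpace.single i 1) (EuclideanSpace.single i 1) ≤ B e e := by
  have hsum : e = ∑ i, e i • EuclideanSpace.single i (1 : ℝ) := by
    simpa using ((EuclideanSpace.basisFun (Fin n) ℝ).sum_repr e).symm
  have h1 : ∑ i, e i * B e (EuclideanSpace.single i 1) = B e e := by
    have : B e e = B e (∑ i, e i • EuclideanSpace.single i (1 : ℝ)) := by rw [← hsum]
    rw [this]
    simp
  have h2 : ∑ i, e i * B (EuclideanSpace.single i 1) e = B e e := by
    have : B e e = B (∑ i, e i • EuclideanSpace.single i (1 : ℝ)) e := by rw [← hsum]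
    rw [this]
    simp
  have h3 : ∑ i, e i ^ 2 = 1 := by
    have := EuclideanSpace.real_norm_sq_eq e
    rw [← this, he, one_pow]
  have h4 : ∑ i, B (EuclideanSpace.single i 1 - e i • e) (EuclideanSpace.single i 1 - e i • e) ≤ 0 :=
    Finset.sum_nonpos fun i _ => hB _
  have h5 : ∀ i, B (EuclideanSpace.single i 1 - e i • e) (EuclideanSpace.single i 1 - e i • e) =
      B (EuclideanSpace.single i 1) (EuclideanSpace.single i 1) -
        e i * B (EuclideanSpace.single i 1) e - e i * B e (EuclideanSpace.single i 1) +
        e i ^ 2 * B e e := by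
    intro i
    simp only [map_sub, map_smul, sub_apply, smul_apply,
      smul_eq_mul]
    ring
  simp only [h5, Finset.sum_add_distrib, Finset.sum_sub_distrib, h1, h2, ← Finset.sum_mul, h3] at h4
  linarith

/-- At a two-point maximum the difference of the curvature operators is controlled by the
one-dimensional curvature operator of `ψ`. -/
theorem graphicalMCOperator_sub_le {n : ℕ} {f : EuclideanSpace ℝ (Fin n) → ℝ}
    (hf : ContDiff ℝ 2 f) {M : ℝ} (hM : 0 < M) {x y : EuclideanSpace ℝ (Fin n)}
    (hxy : x ≠ y) {ψ p : ℝ → ℝ} {q : ℝ}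
    (hψ : ∀ᶠ z in 𝓝 (‖y - x‖ / (2 * M)), HasDerivAt ψ (p z) z)
    (hp : HasDerivAt p q (‖y - x‖ / (2 * M)))
    (hmax : ∀ x' y', f y' - f x' - 2 * M * ψ (‖y' - x'‖ / (2 * M)) ≤
      f y - f x - 2 * M * ψ (‖y - x‖ / (2 * M))) :
    graphicalMCOperator f y - graphicalMCOperator f x ≤
      2 / M * (q / (1 + p (‖y - x‖ / (2 * M)) ^ 2)) := by
  obtain ⟨e, he, hgrad, heq, hB, hq⟩ := exists_unit_of_twoPoint_max hf hM hxy hψ hp hmax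
  set P := p (‖y - x‖ / (2 * M))
  have hgy : gradient f y = P • e := by
    refine ext_inner_right ℝ fun v => ?_
    rw [inner_gradient_left, hgrad, real_inner_smul_left]
  have hgx : gradient f x = P • e := by
    rw [← hgy]; unfold gradient; rw [heq]
  have hnorm : ‖P • e‖ ^ 2 = P ^ 2 := by rw [norm_smul, he, mul_one, Real.norm_eq_abs, sq_abs]
  have htr := sum_apply_single_le
    (B := fderiv ℝ (fderiv ℝ f) y - fderiv ℝ (fderiv ℝ f) x)
    (fun v => by simpa using hB v) he
  simp only [sub_apply, Finset.sum_sub_distrib] at htr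
  rw [graphicalMCOperator_eq hf, graphicalMCOperator_eq hf, hgx, hgy, hnorm]
  simp only [map_smul, smul_apply, smul_eq_mul]
  have hP : 0 < 1 + P ^ 2 := by positivity
  rw [← mul_div_assoc]
  have h1 : (fderiv ℝ (fderiv ℝ f) y e e - fderiv ℝ (fderiv ℝ f) x e e) / (1 + P ^ 2) ≤
      2 / M * q / (1 + P ^ 2) := by gcongr
  have h2 : (fderiv ℝ (fderiv ℝ f) y e e - fderiv ℝ (fderiv ℝ f) x e e) / (1 + P ^ 2) =
      fderiv ℝ (fderiv ℝ f) y e e - fderiv ℝ (fderiv ℝ f) x e e -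
      (P * (P * fderiv ℝ (fderiv ℝ f) y e e) / (1 + P ^ 2) -
        P * (P * fderiv ℝ (fderiv ℝ f) x e e) / (1 + P ^ 2)) := by
    field_simp
    ring
  linarith

/-! ### Barriers for step initial data -/

/-- `ψ` satisfies `ψ_τ ≥ ψ'' / (1 + (ψ')²)` at `(r, τ)` in the classical sense. Here `p` is the spatial
derivative near `r`, `q` the second spatial derivative at `r`, and `s` the time derivative; their
existence is part of the notion. -/
def IsSupersolutionAt (ψ : ℝ → ℝ → ℝ) (r τ : ℝ) : Prop :=
  ∃ (p : ℝ → ℝ) (q s : ℝ), (∀ᶠ z in 𝓝 r, HasDerivAt (fun z => ψ z τ) (p z) z) ∧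
    HasDerivAt p q r ∧ HasDerivAt (fun σ => ψ r σ) s τ ∧ q / (1 + p r ^ 2) ≤ s

/-- The properties of a barrier other than the differential inequality: `ψ` is continuous on
`[0, ∞) × (0, ∞)`, nondecreasing in space, nonnegative at the boundary, and its lower limit as
`τ → 0` is at least `1/2` at every interior point. -/
structure IsStepBarrier (ψ : ℝ → ℝ → ℝ) : Prop where
  continuousOn : ContinuousOn (fun p : ℝ × ℝ => ψ p.1 p.2) (Ici 0 ×ˢ Ioi 0)
  monotone : ∀ τ : ℝ, 0 < τ → MonotoneOn (fun r => ψ r τ) (Ici 0)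
  nonneg_zero : ∀ τ : ℝ, 0 < τ → 0 ≤ ψ 0 τ
  initial : ∀ r : ℝ, 0 < r → ∀ a < (1 / 2 : ℝ), ∀ᶠ τ in 𝓝[>] 0, a ≤ ψ r τ

theorem isStepBarrier_const : IsStepBarrier fun _ _ => 1 / 2 where
  continuousOn := continuousOn_const
  monotone _ _ := monotoneOn_const
  nonneg_zero _ _ := by norm_num
  initial _ _ _ ha := Eventually.of_forall fun _ => ha.le

theorem isSupersolutionAt_const (c r τ : ℝ) : IsSupersolutionAt (fun _ _ => c) r τ :=
  ⟨fun _ => 0, 0, 0, Eventually.of_forall fun _ => hasDerivAt_const _ _, hasDerivAt_const _ _,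
    hasDerivAt_const _ _, by simp⟩

theorem IsStepCurveShortening.isStepBarrier {φ : ℝ → ℝ → ℝ} (hφ : IsStepCurveShortening φ) :
    IsStepBarrier φ where
  continuousOn := hφ.smooth.continuousOn
  monotone := hφ.monotone
  nonneg_zero τ hτ := (hφ.boundary τ hτ).ge
  initial r hr _ ha := (hφ.initial r hr).eventually (Ici_mem_nhds ha)

theorem IsStepCurveShortening.isSupersolutionAt {φ : ℝ → ℝ → ℝ} (hφ : IsStepCurveShortening φ)
    {r τ : ℝ} (hr : 0 < r) (hτ : 0 < τ) : IsSupersolutionAt φ r τ := by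
  have hs : ∀ z : ℝ, 0 < z → ContDiffAt ℝ ∞ (fun p : ℝ × ℝ => φ p.1 p.2) (z, τ) := fun z hz =>
    hφ.smooth.contDiffAt (prod_mem_nhds (Ici_mem_nhds hz) (Ioi_mem_nhds hτ))
  have hx : ∀ z : ℝ, 0 < z → ContDiffAt ℝ ∞ (fun z => φ z τ) z := fun z hz =>
    (hs z hz).comp (f := fun z : ℝ => (z, τ)) z (contDiffAt_id.prodMk contDiffAt_const)
  have ht : ContDiffAt ℝ ∞ (fun σ => φ r σ) τ :=
    (hs r hr).comp (f := fun σ : ℝ => (r, σ)) τ (contDiffAt_const.prodMk contDiffAt_id)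
  have hd : ContDiffAt ℝ 1 (deriv fun z => φ z τ) r := by
    have h := (hx r hr).fderiv_right (m := 1) (by simpa [one_add_one_eq_two] using ENat.LEInfty.out)
    exact h.clm_apply contDiffAt_const
  refine ⟨deriv fun z => φ z τ, deriv (deriv fun z => φ z τ) r, deriv (fun σ => φ r σ) τ,
    ?_, ?_, (ht.differentiableAt (by simp)).hasDerivAt, (hφ.equation r τ hr hτ).ge⟩
  · filter_upwards [lt_mem_nhds hr] with z hz
    exact ((hx z hz).differentiableAt (by simp)).hasDerivAt
  · exact (hd.differentiableAt (by simp)).hasDerivAt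

/-! ### An explicit barrier -/

theorem sinh_le_mul_cosh {w : ℝ} (hw : 0 ≤ w) : Real.sinh w ≤ w * Real.cosh w := by
  have := (convex_Icc 0 w).image_sub_le_mul_sub_of_deriv_le Real.continuous_sinh.continuousOn
    Real.differentiable_sinh.differentiableOn (C := Real.cosh w) (fun x hx => by
      rw [interior_Icc] at hx
      rw [Real.deriv_sinh, Real.cosh_le_cosh, abs_of_pos hx.1, abs_of_nonneg hw]
      exact hx.2.le) 0 ⟨le_rfl, hw⟩ w ⟨hw, le_rfl⟩ hw
  simp at this
  linarith

/-- The frequency `λ(τ) = √(1 / τ² + 1 / (2τ))` of the explicit barrier. It is chosen decreasing, with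
`C' ≥ -λ² C` and `cosh (λ / 2) ≤ exp (1 / τ)`, where `C` is `barrierSlope`. -/
noncomputable def barrierFreq (τ : ℝ) : ℝ := √(1 / τ ^ 2 + 1 / (2 * τ))

/-- The slope `C(τ)` of the explicit barrier at the origin, determined by `1 + C² = exp (2 / τ)`. -/
noncomputable def barrierSlope (τ : ℝ) : ℝ := √(Real.exp (2 / τ) - 1)

/-- The barrier `ψ` with `sinh (λ ψ) = C sin (λ r)` for `λ r ≤ π / 2`, constant in `r` from there on. -/
noncomputable def sineBarrier (r τ : ℝ) : ℝ :=
  Real.arsinh (barrierSlope τ * Real.sin (min (barrierFreq τ * r) (Real.pi / 2))) / barrierFreq τ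

theorem barrierFreq_pos {τ : ℝ} (hτ : 0 < τ) : 0 < barrierFreq τ := by
  unfold barrierFreq; positivity

theorem barrierSlope_pos {τ : ℝ} (hτ : 0 < τ) : 0 < barrierSlope τ := by
  unfold barrierSlope
  have : 1 < Real.exp (2 / τ) := Real.one_lt_exp_iff.2 (by positivity)
  exact Real.sqrt_pos.2 (by linarith)

theorem one_add_barrierSlope_sq {τ : ℝ} (hτ : 0 < τ) :
    1 + barrierSlope τ ^ 2 = Real.exp (2 / τ) := by
  unfold barrierSlope
  have : 1 < Real.exp (2 / τ) := Real.one_lt_exp_iff.2 (by positivity)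
  rw [Real.sq_sqrt (by linarith)]
  ring

theorem barrierFreq_sq {τ : ℝ} (hτ : 0 < τ) :
    barrierFreq τ ^ 2 = 1 / τ ^ 2 + 1 / (2 * τ) := by
  unfold barrierFreq
  exact Real.sq_sqrt (by positivity)

theorem exists_hasDerivAt_barrierFreq {τ : ℝ} (hτ : 0 < τ) :
    ∃ l ≤ 0, HasDerivAt barrierFreq l τ := by
  have h1 : HasDerivAt (fun τ : ℝ => 1 / τ ^ 2 + 1 / (2 * τ))
      (-(2 / τ ^ 3 + 1 / (2 * τ ^ 2))) τ := by
    simp only [one_div]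
    refine HasDerivAt.congr_deriv (((hasDerivAt_pow 2 τ).inv (by positivity)).add
      (((hasDerivAt_id' τ).const_mul 2).inv (by positivity))) ?_
    field_simp
    ring
  have h2 := h1.sqrt (by positivity)
  refine ⟨_, ?_, h2⟩
  exact div_nonpos_of_nonpos_of_nonneg (neg_nonpos.2 (by positivity)) (by positivity)

/-- The explicit slope decays no faster than in the exact solution of constant frequency `λ`, where
`C' = -λ² C`. This reduces to `2 / τ + 1 ≤ exp (2 / τ)`. -/
theorem exists_hasDerivAt_barrierSlope {τ : ℝ} (hτ : 0 < τ) :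
    ∃ c, -(barrierFreq τ ^ 2 * barrierSlope τ) ≤ c ∧ HasDerivAt barrierSlope c τ := by
  have hC := barrierSlope_pos hτ
  have hC2 := one_add_barrierSlope_sq hτ
  have h1 : HasDerivAt (fun τ : ℝ => Real.exp (2 / τ) - 1) (Real.exp (2 / τ) * (-2 / τ ^ 2)) τ := by
    simp only [div_eq_mul_inv]
    refine (((hasDerivAt_inv hτ.ne').const_mul 2).exp.sub_const 1).congr_deriv ?_
    ring
  have h2 := h1.sqrt (by nlinarith)
  refine ⟨_, ?_, h2⟩
  change _ ≤ _ / (2 * barrierSlope τ)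
  rw [le_div_iff₀ (by positivity), barrierFreq_sq hτ]
  have h3 : 2 / τ + 1 ≤ Real.exp (2 / τ) := Real.add_one_le_exp _
  have h4 : barrierSlope τ ^ 2 = Real.exp (2 / τ) - 1 := by linarith
  have h5 : -((1 / τ ^ 2 + 1 / (2 * τ)) * barrierSlope τ) * (2 * barrierSlope τ) =
      -2 * (1 / τ ^ 2 + 1 / (2 * τ)) * barrierSlope τ ^ 2 := by ring
  rw [h5, h4]
  have h6 : Real.exp (2 / τ) * (-2 / τ ^ 2) -
      -2 * (1 / τ ^ 2 + 1 / (2 * τ)) * (Real.exp (2 / τ) - 1) =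
      (Real.exp (2 / τ) - (2 / τ + 1)) / τ := by field_simp; ring
  have h7 : 0 ≤ (Real.exp (2 / τ) - (2 / τ + 1)) / τ := div_nonneg (by linarith) hτ.le
  linarith

/-- Equivalent to `cosh (λ / 2) ≤ exp (1 / τ)`, which says that the crest of the barrier has height at
least `1/2`. -/
theorem half_barrierFreq_le_arsinh {τ : ℝ} (hτ : 0 < τ) :
    barrierFreq τ / 2 ≤ Real.arsinh (barrierSlope τ) := by
  have hl := barrierFreq_pos hτ
  have hl2 := barrierFreq_sq hτ
  rw [← Real.sinh_le_sinh, Real.sinh_arsinh]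
  refine (sq_le_sq₀ (Real.sinh_nonneg_iff.2 (by positivity)) (barrierSlope_pos hτ).le).1 ?_
  have h1 : Real.cosh (barrierFreq τ / 2) ≤ Real.exp (1 / τ) := by
    -- For `τ ≤ 6` the bound `cosh z ≤ exp z` suffices, for larger `τ` the bound
    -- `cosh z ≤ exp (z² / 2)` does.
    rcases le_total τ 6 with h | h
    · have h2 : Real.cosh (barrierFreq τ / 2) ≤ Real.exp (barrierFreq τ / 2) := by
        have := Real.exp_le_exp.2 (show -(barrierFreq τ / 2) ≤ barrierFreq τ / 2 by linarith)
        rw [Real.cosh_eq]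
        linarith
      refine h2.trans (Real.exp_le_exp.2 ?_)
      refine (sq_le_sq₀ (by positivity) (by positivity)).1 ?_
      rw [div_pow, hl2, ← sub_nonneg]
      have : (1 / τ) ^ 2 - (1 / τ ^ 2 + 1 / (2 * τ)) / 2 ^ 2 = (6 - τ) / (8 * τ ^ 2) := by
        field_simp
        ring
      rw [this]
      exact div_nonneg (by linarith) (by positivity)
    · refine (Real.cosh_le_exp_half_sq _).trans (Real.exp_le_exp.2 ?_)
      rw [div_pow, hl2, ← sub_nonneg]
      have : 1 / τ - (1 / τ ^ 2 + 1 / (2 * τ)) / 2 ^ 2 / 2 = (15 * τ - 2) / (16 * τ ^ 2) := by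
        field_simp
        ring
      rw [this]
      exact div_nonneg (by linarith) (by positivity)
  have h2 := Real.cosh_sq (barrierFreq τ / 2)
  have h3 : Real.exp (2 / τ) = Real.exp (1 / τ) ^ 2 := by
    rw [← Real.exp_nat_mul]; congr 1; push_cast; ring
  have h4 := one_add_barrierSlope_sq hτ
  have h5 : Real.cosh (barrierFreq τ / 2) ^ 2 ≤ Real.exp (1 / τ) ^ 2 := by
    gcongr
  linarith

theorem sineBarrier_le {r τ : ℝ} (hr : 0 ≤ r) (hτ : 0 < τ) :
    sineBarrier r τ ≤ barrierSlope τ * r := by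
  have hl := barrierFreq_pos hτ
  have hC := barrierSlope_pos hτ
  have h0 := Real.pi_pos
  have hm : 0 ≤ min (barrierFreq τ * r) (Real.pi / 2) := by positivity
  have hs : Real.sin (min (barrierFreq τ * r) (Real.pi / 2)) ≤ barrierFreq τ * r :=
    (Real.sin_le hm).trans (min_le_left _ _)
  have hs0 : 0 ≤ Real.sin (min (barrierFreq τ * r) (Real.pi / 2)) :=
    Real.sin_nonneg_of_nonneg_of_le_pi hm ((min_le_right _ _).trans (by linarith))
  unfold sineBarrier
  rw [div_le_iff₀ hl]
  have h1 : Real.arsinh (barrierSlope τ * Real.sin (min (barrierFreq τ * r) (Real.pi / 2))) ≤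
      barrierSlope τ * Real.sin (min (barrierFreq τ * r) (Real.pi / 2)) := by
    have := Real.self_le_sinh_iff.2 (Real.arsinh_nonneg_iff.2 (mul_nonneg hC.le hs0))
    rwa [Real.sinh_arsinh] at this
  calc _ ≤ _ := h1
    _ ≤ barrierSlope τ * (barrierFreq τ * r) := by gcongr
    _ = _ := by ring

theorem half_le_sineBarrier {r τ : ℝ} (hτ : 0 < τ) (h : Real.pi / 2 ≤ barrierFreq τ * r) :
    1 / 2 ≤ sineBarrier r τ := by
  unfold sineBarrier
  rw [min_eq_right h, Real.sin_pi_div_two, mul_one, le_div_iff₀ (barrierFreq_pos hτ)]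
  linarith [half_barrierFreq_le_arsinh hτ]

theorem isStepBarrier_sineBarrier : IsStepBarrier sineBarrier where
  continuousOn := by
    have h1 : ContinuousOn (fun p : ℝ × ℝ => barrierFreq p.2) (Ici 0 ×ˢ Ioi 0) := by
      unfold barrierFreq
      refine ContinuousOn.sqrt (ContinuousOn.add (continuousOn_const.div (by fun_prop) ?_)
        (continuousOn_const.div (by fun_prop) ?_))
      all_goals
        rintro ⟨r, τ⟩ ⟨-, h⟩
        have : 0 < τ := h
        positivity
    have h2 : ContinuousOn (fun p : ℝ × ℝ => barrierSlope p.2) (Ici 0 ×ˢ Ioi 0) := by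
      unfold barrierSlope
      refine ContinuousOn.sqrt (ContinuousOn.sub (ContinuousOn.rexp
        (continuousOn_const.div (by fun_prop) ?_)) continuousOn_const)
      rintro ⟨r, τ⟩ ⟨-, h⟩
      exact (ne_of_gt h : τ ≠ 0)
    unfold sineBarrier
    have h3 : ContinuousOn (fun p : ℝ × ℝ => min (barrierFreq p.2 * p.1) (Real.pi / 2))
        (Ici 0 ×ˢ Ioi 0) := (h1.mul continuousOn_fst).inf continuousOn_const
    refine ContinuousOn.div (Real.continuous_arsinh.comp_continuousOn (h2.mul
      (Real.continuous_sin.comp_continuousOn h3))) h1 ?_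
    rintro ⟨r, τ⟩ ⟨-, h⟩
    exact (barrierFreq_pos h).ne'
  monotone τ hτ r (hr : 0 ≤ r) r' (hr' : 0 ≤ r') hrr := by
    have hl := barrierFreq_pos hτ
    have hC := barrierSlope_pos hτ
    have h0 := Real.pi_pos
    change sineBarrier r τ ≤ sineBarrier r' τ
    unfold sineBarrier
    have : Real.sin (min (barrierFreq τ * r) (Real.pi / 2)) ≤
        Real.sin (min (barrierFreq τ * r') (Real.pi / 2)) := by
      refine Real.sin_le_sin_of_le_of_le_pi_div_two ?_ (min_le_right _ _) (by gcongr)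
      have : 0 ≤ min (barrierFreq τ * r) (Real.pi / 2) := by positivity
      linarith
    gcongr
  nonneg_zero τ hτ := by
    have := Real.pi_pos
    unfold sineBarrier
    rw [mul_zero, min_eq_left (by positivity)]
    simp
  initial r hr a ha := by
    have h1 : Tendsto (fun τ : ℝ => r * τ⁻¹) (𝓝[>] 0) atTop :=
      tendsto_inv_nhdsGT_zero.const_mul_atTop hr
    filter_upwards [self_mem_nhdsWithin, h1.eventually_ge_atTop (Real.pi / 2)] with τ hτ h
    have hτ : 0 < τ := hτ
    refine ha.le.trans (half_le_sineBarrier hτ (h.trans ?_))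
    rw [mul_comm]
    gcongr
    refine Real.le_sqrt_of_sq_le ?_
    rw [inv_pow, one_div]
    have : 0 ≤ 1 / (2 * τ) := by positivity
    linarith

theorem isSupersolutionAt_sineBarrier {r τ : ℝ} (hr : 0 < r) (hτ : 0 < τ)
    (hlt : sineBarrier r τ < 1 / 2) : IsSupersolutionAt sineBarrier r τ := by
  have hl := barrierFreq_pos hτ
  have hC := barrierSlope_pos hτ
  have hθ : barrierFreq τ * r < Real.pi / 2 := by
    by_contra! h
    exact hlt.not_ge (half_le_sineBarrier hτ h)
  obtain ⟨l, hl0, hl'⟩ := exists_hasDerivAt_barrierFreq hτ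
  obtain ⟨c, hc0, hc'⟩ := exists_hasDerivAt_barrierSlope hτ
  have hx : ∀ᶠ z in 𝓝 r, barrierFreq τ * z < Real.pi / 2 :=
    (continuous_const.mul continuous_id).continuousAt.eventually_lt continuousAt_const hθ
  have ht : ∀ᶠ σ in 𝓝 τ, barrierFreq σ * r < Real.pi / 2 :=
    (hl'.continuousAt.mul continuousAt_const).eventually_lt continuousAt_const hθ
  set C := barrierSlope τ with hCdef
  set k := barrierFreq τ with hkdef
  have hsin : ∀ z : ℝ, HasDerivAt (fun z => C * Real.sin (k * z)) (C * (Real.cos (k * z) * k)) z :=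
    fun z => by
      have := (((hasDerivAt_id z).const_mul k).sin).const_mul C
      simpa using this
  have hcos : ∀ z : ℝ, HasDerivAt (fun z => C * Real.cos (k * z)) (-(C * (Real.sin (k * z) * k))) z :=
    fun z => by
      have := (((hasDerivAt_id z).const_mul k).cos).const_mul C
      simpa using this
  have hR : ∀ z : ℝ, 0 < 1 + (C * Real.sin (k * z)) ^ 2 := fun z => by positivity
  have h1 : ∀ z : ℝ, HasDerivAt (fun z => Real.arsinh (C * Real.sin (k * z)) / k)
      (C * Real.cos (k * z) / √(1 + (C * Real.sin (k * z)) ^ 2)) z := fun z => by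
    have := ((hsin z).arsinh).div_const k
    refine this.congr_deriv ?_
    simp only [smul_eq_mul]
    field_simp
  have h2 := (hcos r).div ((((hsin r).pow 2).const_add 1).sqrt (hR r).ne') (Real.sqrt_pos.2 (hR r)).ne'
  have h3 : HasDerivAt (fun σ => Real.arsinh (barrierSlope σ * Real.sin (barrierFreq σ * r)) /
      barrierFreq σ) _ τ :=
    ((hc'.mul ((hl'.mul_const r).sin)).arsinh).div hl' hl.ne'
  refine ⟨_, _, _, ?_, h2, h3.congr_of_eventuallyEq ?_, ?_⟩
  · filter_upwards [hx.eventually_nhds] with z hz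
    refine (h1 z).congr_of_eventuallyEq ?_
    filter_upwards [hz] with w hw
    unfold sineBarrier
    rw [min_eq_left hw.le]
  · filter_upwards [ht] with σ hσ
    unfold sineBarrier
    rw [min_eq_left hσ.le]
  · simp only [← hCdef, ← hkdef, smul_eq_mul, Pi.pow_apply]
    have hθ0 : 0 < k * r := by positivity
    have hs : 0 < Real.sin (k * r) := Real.sin_pos_of_pos_of_lt_pi hθ0 (by linarith [Real.pi_pos])
    have hco : 0 < Real.cos (k * r) := Real.cos_pos_of_mem_Ioo ⟨by linarith, hθ⟩
    have hW2 := Real.sq_sqrt (hR r).le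
    have hW : 0 < √(1 + (C * Real.sin (k * r)) ^ 2) := Real.sqrt_pos.2 (hR r)
    have hw0 : 0 ≤ Real.arsinh (C * Real.sin (k * r)) := Real.arsinh_nonneg_iff.2 (by positivity)
    -- `C θ cos θ ≤ C sin θ = sinh w ≤ w cosh w`
    have hkey : C * (k * r) * Real.cos (k * r) ≤
        Real.arsinh (C * Real.sin (k * r)) * √(1 + (C * Real.sin (k * r)) ^ 2) := by
      have ha : k * r * Real.cos (k * r) ≤ Real.sin (k * r) := by
        have := Real.le_tan hθ0.le hθ
        rwa [Real.tan_eq_sin_div_cos, le_div_iff₀ hco] at this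
      have hb : C * Real.sin (k * r) ≤
          Real.arsinh (C * Real.sin (k * r)) * √(1 + (C * Real.sin (k * r)) ^ 2) := by
        have := sinh_le_mul_cosh hw0
        rwa [Real.sinh_arsinh, Real.cosh_arsinh] at this
      nlinarith
    set S := C * Real.sin (k * r) with hS
    set W := √(1 + S ^ 2)
    set w := Real.arsinh S
    -- The curvature term `ψ'' / (1 + (ψ')²)` equals `-λ tanh w`, where `w = λ ψ` and `S = sinh w`.
    have hq : (-(C * (Real.sin (k * r) * k)) * W - C * Real.cos (k * r) *
        (2 * S * (C * (Real.cos (k * r) * k)) / (2 * W))) / W ^ 2 /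
        (1 + (C * Real.cos (k * r) / W) ^ 2) = -(k * S / W) := by
      have hne : 0 < W ^ 2 + (C * Real.cos (k * r)) ^ 2 := by positivity
      field_simp
      rw [hS]
      ring
    -- After multiplication by `λ W` the deficit is the sum of the terms `(C' + λ² C) sin θ` and
    -- `-λ' (w cosh w - C θ cos θ)` up to positive factors, where `W = cosh w`.
    have hs' : -(k * S / W) ≤ (W⁻¹ * (c * Real.sin (k * r) + C * (Real.cos (k * r) * (l * r))) * k -
        w * l) / k ^ 2 := by
      rw [le_div_iff₀ (by positivity)]
      have : (W⁻¹ * (c * Real.sin (k * r) + C * (Real.cos (k * r) * (l * r))) * k - w * l) -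
          -(k * S / W) * k ^ 2 =
          (k * ((c + k ^ 2 * C) * Real.sin (k * r)) + (-l) * (w * W - C * (k * r) * Real.cos (k * r))) / W := by
        field_simp
        rw [hS]
        ring
      have h0 : 0 ≤ (k * ((c + k ^ 2 * C) * Real.sin (k * r)) +
          (-l) * (w * W - C * (k * r) * Real.cos (k * r))) / W := by
        have h1 : 0 ≤ c + k ^ 2 * C := by linarith
        have h2 : 0 ≤ -l := by linarith
        have h3 : 0 ≤ w * W - C * (k * r) * Real.cos (k * r) := by linarith
        positivity
      linarith
    refine le_trans (le_of_eq ?_) (hs'.trans (le_of_eq ?_))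
    · rw [← hq]
      simp
      rfl
    · simp
      rfl

/-! ### Lattice periodicity -/

theorem IsGammaPeriodic.add_mem_span {n : ℕ} {Γ : Fin n → EuclideanSpace ℝ (Fin n)}
    {f : EuclideanSpace ℝ (Fin n) → ℝ} (hf : IsGammaPeriodic Γ f)
    {v : EuclideanSpace ℝ (Fin n)} (hv : v ∈ Submodule.span ℤ (range Γ)) :
    ∀ x, f (x + v) = f x := by
  induction hv using Submodule.span_induction with
  | mem v hv =>
    obtain ⟨i, rfl⟩ := hv
    exact fun x => hf x i
  | zero => simp
  | add v w _ _ h1 h2 => intro x; rw [← add_assoc, h2, h1]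
  | smul k v _ h =>
    induction k using Int.induction_on with
    | zero => simp
    | succ k ih => intro x; rw [add_smul, one_smul, ← add_assoc, h, ih]
    | pred k ih =>
      intro x
      have := h (x + (-(k : ℤ) - 1) • v)
      rw [← this, add_assoc, sub_smul, one_smul, sub_add_cancel, ih]

/-- Every point has a translate by the lattice in a fixed ball. -/
theorem exists_norm_add_mem_span_le {n : ℕ} {Γ : Fin n → EuclideanSpace ℝ (Fin n)}
    (hΓ : LinearIndependent ℝ Γ) :
    ∃ R : ℝ, ∀ x : EuclideanSpace ℝ (Fin n), ∃ v ∈ Submodule.span ℤ (range Γ), ‖x + v‖ ≤ R := by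
  have hc : Fintype.card (Fin n) = Module.finrank ℝ (EuclideanSpace ℝ (Fin n)) := by simp
  have hspan : ⊤ ≤ Submodule.span ℝ (range Γ) := (hΓ.span_eq_top_of_card_eq_finrank' hc).ge
  let b := Module.Basis.mk hΓ hspan
  have hb : ⇑b = Γ := Module.Basis.coe_mk hΓ hspan
  refine ⟨∑ i, ‖b i‖, fun x => ⟨-(ZSpan.floor b x : EuclideanSpace ℝ (Fin n)), ?_, ?_⟩⟩
  · exact neg_mem ((congrArg (fun g : Fin n → EuclideanSpace ℝ (Fin n) =>
      (ZSpan.floor b x : EuclideanSpace ℝ (Fin n)) ∈ Submodule.span ℤ (range g)) hb).mp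
      (ZSpan.floor b x).2)
  · rw [← sub_eq_add_neg, ← ZSpan.fract_apply]
    exact ZSpan.norm_fract_le b x

/-! ### Comparison for periodic solutions -/

section Flow

variable {n : ℕ} {Γ : Fin n → EuclideanSpace ℝ (Fin n)} {T : EReal}
  {u : EuclideanSpace ℝ (Fin n) → ℝ → ℝ}

theorem IsSmoothGraphicalMCF.contDiffAt (hu : IsSmoothGraphicalMCF T u)
    (x : EuclideanSpace ℝ (Fin n)) {t : ℝ} (ht : 0 < t) (htT : (t : EReal) < T) :
    ContDiffAt ℝ ∞ (fun p : EuclideanSpace ℝ (Fin n) × ℝ => u p.1 p.2) (x, t) := by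
  refine hu.smooth.contDiffAt ?_
  have h1 : ∀ᶠ s : ℝ in 𝓝 t, (s : EReal) < T :=
    continuous_coe_real_ereal.continuousAt.eventually_lt continuousAt_const htT
  have h2 : ∀ᶠ s : ℝ in 𝓝 t, 0 ≤ s ∧ (s : EReal) < T := (le_mem_nhds ht).and h1
  exact (continuous_snd.tendsto (x, t)).eventually h2

theorem IsSmoothGraphicalMCF.contDiff_slice (hu : IsSmoothGraphicalMCF T u) {t : ℝ} (ht : 0 < t)
    (htT : (t : EReal) < T) : ContDiff ℝ ∞ fun x => u x t :=
  contDiff_iff_contDiffAt.2 fun x => (hu.contDiffAt x ht htT).comp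
    (f := fun x : EuclideanSpace ℝ (Fin n) => (x, t)) x (contDiffAt_id.prodMk contDiffAt_const)

theorem IsSmoothGraphicalMCF.hasDerivAt (hu : IsSmoothGraphicalMCF T u)
    (x : EuclideanSpace ℝ (Fin n)) {t : ℝ} (ht : 0 < t) (htT : (t : EReal) < T) :
    HasDerivAt (fun s => u x s) (graphicalMCOperator (fun z => u z t) x) t := by
  rw [← hu.equation x t ht htT]
  have h : ContDiffAt ℝ ∞ (fun s => u x s) t := (hu.contDiffAt x ht htT).comp
    (f := fun s : ℝ => (x, s)) t (contDiffAt_const.prodMk contDiffAt_id)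
  exact (h.differentiableAt (by simp)).hasDerivAt

/-- Periodicity makes `u` uniformly continuous on `ℝⁿ × [0, t₁]`, although this set is not compact. -/
theorem exists_uniform_delta_of_periodic (hΓ : LinearIndependent ℝ Γ) {t₁ : ℝ}
    (hcont : ContinuousOn (fun p : EuclideanSpace ℝ (Fin n) × ℝ => u p.1 p.2) (univ ×ˢ Icc 0 t₁))
    (hper : ∀ t ∈ Icc 0 t₁, IsGammaPeriodic Γ fun x => u x t) {η : ℝ} (hη : 0 < η) :
    ∃ δ > 0, ∀ x y, ∀ s ∈ Icc 0 t₁, ∀ t ∈ Icc 0 t₁, ‖y - x‖ < δ → |t - s| < δ →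
      |u y t - u x s| < η := by
  obtain ⟨R, hR⟩ := exists_norm_add_mem_span_le hΓ
  have hK : IsCompact (Metric.closedBall (0 : EuclideanSpace ℝ (Fin n)) (R + 1) ×ˢ Icc 0 t₁) :=
    (isCompact_closedBall _ _).prod isCompact_Icc
  have huc := hK.uniformContinuousOn_of_continuous
    (hcont.mono (prod_mono (subset_univ _) Subset.rfl))
  obtain ⟨δ, hδ, h⟩ := Metric.uniformContinuousOn_iff.1 huc η hη
  refine ⟨min δ 1, by positivity, fun x y s hs t ht hxy hst => ?_⟩
  obtain ⟨v, hv, hx⟩ := hR x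
  have h1 := (hper s hs).add_mem_span hv x
  have h2 := (hper t ht).add_mem_span hv y
  rw [← h1, ← h2]
  have hd : ‖(y + v) - (x + v)‖ < min δ 1 := by rwa [add_sub_add_right_eq_sub]
  refine h (y + v, t) ⟨?_, ht⟩ (x + v, s) ⟨?_, hs⟩ ?_
  · rw [mem_closedBall_zero_iff]
    have := norm_le_norm_add_norm_sub' (y + v) (x + v)
    have := min_le_right δ 1
    linarith
  · rw [mem_closedBall_zero_iff]
    linarith
  · rw [Prod.dist_eq, dist_eq_norm, Real.dist_eq]
    exact max_lt (hd.trans_le (min_le_left _ _)) (hst.trans_le (min_le_left _ _))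

/-- Comparison of the modulus of continuity of a periodic solution with a barrier. The differential
inequality for `ψ` is needed only at the points where the claimed bound would be violated. -/
theorem IsStepBarrier.sub_le {ψ : ℝ → ℝ → ℝ} (hψ : IsStepBarrier ψ) (hΓ : LinearIndependent ℝ Γ)
    (hu : IsSmoothGraphicalMCF T u) {M : ℝ} (hM : 0 < M)
    (hosc : ∀ x y, |u x 0 - u y 0| ≤ M)
    (hper : ∀ t : ℝ, 0 ≤ t → (t : EReal) < T → IsGammaPeriodic Γ fun x => u x t)
    (hsuper : ∀ (x y : EuclideanSpace ℝ (Fin n)) (t : ℝ), x ≠ y → 0 < t → (t : EReal) < T →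
      2 * M * ψ (‖y - x‖ / (2 * M)) (t / M ^ 2) < u y t - u x t →
      IsSupersolutionAt ψ (‖y - x‖ / (2 * M)) (t / M ^ 2))
    (x y : EuclideanSpace ℝ (Fin n)) {t : ℝ} (ht : 0 < t) (htT : (t : EReal) < T) :
    u y t - u x t ≤ 2 * M * ψ (‖y - x‖ / (2 * M)) (t / M ^ 2) := by
  have hT : ∀ s : ℝ, s ≤ t → (s : EReal) < T := fun s hs =>
    (EReal.coe_le_coe_iff.2 hs).trans_lt htT
  have hcont : ContinuousOn (fun p : EuclideanSpace ℝ (Fin n) × ℝ => u p.1 p.2)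
      (univ ×ˢ Icc 0 t) :=
    hu.smooth.continuousOn.mono fun p hp => ⟨hp.2.1, hT _ hp.2.2⟩
  obtain ⟨R, hR⟩ := exists_norm_add_mem_span_le hΓ
  suffices H : ∀ η > 0, u y t - u x t ≤
      2 * M * ψ (‖y - x‖ / (2 * M)) (t / M ^ 2) + η * (1 + t) by
    refine le_of_forall_pos_le_add fun ε hε => ?_
    have := H (ε / (1 + t)) (by positivity)
    rwa [div_mul_cancel₀ _ (by positivity)] at this
  intro η hη
  obtain ⟨δ, hδ, hunif⟩ := exists_uniform_delta_of_periodic hΓ hcont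
    (fun s hs => hper s hs.1 (hT s hs.2)) (half_pos (half_pos hη))
  have hψ0 : ∀ {r τ : ℝ}, 0 ≤ r → 0 < τ → 0 ≤ ψ r τ := fun hr hτ =>
    (hψ.nonneg_zero _ hτ).trans (hψ.monotone _ hτ (mem_Ici.2 le_rfl) (mem_Ici.2 hr) hr)
  -- An initial time at which the inequality holds with room to spare.
  obtain ⟨ε, hε, hεt, hinit⟩ : ∃ ε > 0, ε ≤ t ∧ ∀ x y, u y ε - u x ε <
      2 * M * ψ (‖y - x‖ / (2 * M)) (ε / M ^ 2) + η := by
    have h1 : Tendsto (fun ε : ℝ => ε / M ^ 2) (𝓝[>] 0) (𝓝[>] 0) := by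
      refine tendsto_nhdsWithin_iff.2 ⟨?_, ?_⟩
      · have : Tendsto (fun ε : ℝ => ε / M ^ 2) (𝓝 0) (𝓝 (0 / M ^ 2)) :=
          tendsto_id.div_const _
        rw [zero_div] at this
        exact this.mono_left nhdsWithin_le_nhds
      · filter_upwards [self_mem_nhdsWithin] with ε (hε : 0 < ε)
        exact div_pos hε (by positivity)
    have h2 := h1.eventually (hψ.initial (δ / (2 * M)) (by positivity)
      (1 / 2 - η / (4 * M)) (by linarith [show 0 < η / (4 * M) by positivity]))
    have h3 : ∀ᶠ ε : ℝ in 𝓝[>] 0, ε < min t δ :=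
      nhdsWithin_le_nhds (gt_mem_nhds (lt_min ht hδ))
    obtain ⟨ε, h2, h3, hε⟩ := (h2.and (h3.and self_mem_nhdsWithin)).exists
    have hε : 0 < ε := hε
    have hετ : 0 < ε / M ^ 2 := by positivity
    have hεt : ε ≤ t := (h3.trans_le (min_le_left _ _)).le
    refine ⟨ε, hε, hεt, fun x y => ?_⟩
    -- Nearby points: uniform continuity of `u`. Distant points: `ψ` is almost `1/2` there.
    rcases lt_or_ge ‖y - x‖ δ with hxy | hxy
    · have h4 := hunif x y ε ⟨hε.le, hεt⟩ ε ⟨hε.le, hεt⟩ hxy (by simpa using hδ)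
      have h5 := hψ0 (r := ‖y - x‖ / (2 * M)) (by positivity) hετ
      have h6 : 0 ≤ 2 * M * ψ (‖y - x‖ / (2 * M)) (ε / M ^ 2) := by positivity
      linarith [(abs_lt.1 h4).2]
    · have h4 : ∀ z, |u z ε - u z 0| < η / 2 / 2 := fun z =>
        hunif z z 0 ⟨le_rfl, ht.le⟩ ε ⟨hε.le, hεt⟩ (by simpa using hδ)
          (by rw [sub_zero, abs_of_pos hε]; exact h3.trans_le (min_le_right _ _))
      have h5 : ψ (δ / (2 * M)) (ε / M ^ 2) ≤ ψ (‖y - x‖ / (2 * M)) (ε / M ^ 2) :=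
        hψ.monotone _ hετ (mem_Ici.2 (by positivity)) (mem_Ici.2 (by positivity)) (by gcongr)
      have h6 : M - η / 2 ≤ 2 * M * ψ (‖y - x‖ / (2 * M)) (ε / M ^ 2) := by
        calc M - η / 2 = 2 * M * (1 / 2 - η / (4 * M)) := by field_simp; ring
          _ ≤ _ := by gcongr; exact h2.trans h5
      have h7 := abs_le.1 (hosc y x)
      have h8 := abs_lt.1 (h4 x)
      have h9 := abs_lt.1 (h4 y)
      linarith
  -- The term `η (1 + s)` makes the differential inequality at a maximum strict.
  set Z : EuclideanSpace ℝ (Fin n) × EuclideanSpace ℝ (Fin n) × ℝ → ℝ := fun p =>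
    u p.2.1 p.2.2 - u p.1 p.2.2 - 2 * M * ψ (‖p.2.1 - p.1‖ / (2 * M)) (p.2.2 / M ^ 2) -
      η * (1 + p.2.2) with hZ
  have hZcont : ContinuousOn Z (univ ×ˢ univ ×ˢ Icc ε t) := by
    have ha : ContinuousOn (fun p : EuclideanSpace ℝ (Fin n) × EuclideanSpace ℝ (Fin n) × ℝ =>
        u p.2.1 p.2.2) (univ ×ˢ univ ×ˢ Icc ε t) :=
      hcont.comp (f := fun p : EuclideanSpace ℝ (Fin n) × EuclideanSpace ℝ (Fin n) × ℝ =>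
        (p.2.1, p.2.2)) (by fun_prop) fun p hp => ⟨trivial, hε.le.trans hp.2.2.1, hp.2.2.2⟩
    have hb : ContinuousOn (fun p : EuclideanSpace ℝ (Fin n) × EuclideanSpace ℝ (Fin n) × ℝ =>
        u p.1 p.2.2) (univ ×ˢ univ ×ˢ Icc ε t) :=
      hcont.comp (f := fun p : EuclideanSpace ℝ (Fin n) × EuclideanSpace ℝ (Fin n) × ℝ =>
        (p.1, p.2.2)) (by fun_prop) fun p hp => ⟨trivial, hε.le.trans hp.2.2.1, hp.2.2.2⟩
    have hc : ContinuousOn (fun p : EuclideanSpace ℝ (Fin n) × EuclideanSpace ℝ (Fin n) × ℝ =>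
        ψ (‖p.2.1 - p.1‖ / (2 * M)) (p.2.2 / M ^ 2)) (univ ×ˢ univ ×ˢ Icc ε t) :=
      hψ.continuousOn.comp
        (f := fun p : EuclideanSpace ℝ (Fin n) × EuclideanSpace ℝ (Fin n) × ℝ =>
          (‖p.2.1 - p.1‖ / (2 * M), p.2.2 / M ^ 2)) (by fun_prop) fun p hp =>
          ⟨mem_Ici.2 (by positivity), mem_Ioi.2 (div_pos (hε.trans_le hp.2.2.1) (by positivity))⟩
    exact ((ha.sub hb).sub (continuousOn_const.mul hc)).sub (by fun_prop)
  have hKc : IsCompact (Metric.closedBall (0 : EuclideanSpace ℝ (Fin n)) R ×ˢ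
      Metric.closedBall (0 : EuclideanSpace ℝ (Fin n)) (R + R) ×ˢ Icc ε t) :=
    (isCompact_closedBall _ _).prod ((isCompact_closedBall _ _).prod isCompact_Icc)
  -- Lattice translations reduce every pair of points to the compact set.
  have hred : ∀ x y, ∀ s ∈ Icc ε t, ∃ p ∈ Metric.closedBall (0 : EuclideanSpace ℝ (Fin n)) R ×ˢ
      Metric.closedBall (0 : EuclideanSpace ℝ (Fin n)) (R + R) ×ˢ Icc ε t,
      Z (x, y, s) ≤ Z p := by
    intro x y s hs
    have hs0 : 0 < s := hε.trans_le hs.1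
    have hps := hper s hs0.le (hT s hs.2)
    obtain ⟨v, hv, hxv⟩ := hR x
    obtain ⟨w, hw, hyw, hle⟩ : ∃ w ∈ Submodule.span ℤ (range Γ), ‖y - x + w‖ ≤ R ∧
        ‖y - x + w‖ ≤ ‖y - x‖ := by
      rcases le_total ‖y - x‖ R with h | h
      · exact ⟨0, zero_mem _, by simpa using h, by simp⟩
      · obtain ⟨w, hw, hyw⟩ := hR (y - x)
        exact ⟨w, hw, hyw, hyw.trans h⟩
    have hdiff : (y + (v + w)) - (x + v) = y - x + w := by abel
    refine ⟨(x + v, y + (v + w), s), ⟨?_, ?_, hs⟩, ?_⟩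
    · simpa using hxv
    · rw [mem_closedBall_zero_iff]
      have := norm_add_le (x + v) (y - x + w)
      rw [← hdiff, add_sub_cancel, hdiff] at this
      exact this.trans (add_le_add hxv hyw)
    · have h1 := hps.add_mem_span hv x
      have h2 := hps.add_mem_span (add_mem hv hw) y
      simp only [hZ, h1, h2, hdiff]
      have h3 : ψ (‖y - x + w‖ / (2 * M)) (s / M ^ 2) ≤ ψ (‖y - x‖ / (2 * M)) (s / M ^ 2) :=
        hψ.monotone _ (by positivity) (mem_Ici.2 (by positivity)) (mem_Ici.2 (by positivity))
          (by gcongr)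
      gcongr
  obtain ⟨p₁, hp₁, -⟩ := hred x y t ⟨hεt, le_rfl⟩
  obtain ⟨⟨x₀, y₀, t₀⟩, hp₀, hmax⟩ := hKc.exists_isMaxOn ⟨p₁, hp₁⟩
    (hZcont.mono (prod_mono (subset_univ _) (prod_mono (subset_univ _) Subset.rfl)))
  have ht₀ : t₀ ∈ Icc ε t := hp₀.2.2
  have hglob : ∀ x y, ∀ s ∈ Icc ε t, Z (x, y, s) ≤ Z (x₀, y₀, t₀) := by
    intro x y s hs
    obtain ⟨p, hp, h⟩ := hred x y s hs
    exact h.trans (hmax hp)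
  suffices hle : Z (x₀, y₀, t₀) ≤ 0 by
    have := (hglob x y t ⟨hεt, le_rfl⟩).trans hle
    simp only [hZ] at this
    linarith
  by_contra! hpos
  have ht₀0 : 0 < t₀ := hε.trans_le ht₀.1
  have hτ₀ : 0 < t₀ / M ^ 2 := by positivity
  have ht₀T := hT t₀ ht₀.2
  have hxy₀ : x₀ ≠ y₀ := by
    rintro rfl
    have h1 := hψ.nonneg_zero _ hτ₀
    have h2 : 0 ≤ 2 * M * ψ 0 (t₀ / M ^ 2) := by positivity
    have h3 : 0 < η * (1 + t₀) := by positivity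
    simp only [hZ, sub_self, norm_zero, zero_div] at hpos
    linarith
  -- The maximum is attained after the initial time, so the left time derivative is nonnegative there.
  have hεt₀ : ε < t₀ := by
    refine lt_of_le_of_ne ht₀.1 ?_
    rintro rfl
    have h1 := hinit x₀ y₀
    have h3 : 0 < η * ε := by positivity
    simp only [hZ] at hpos
    linarith
  obtain ⟨p, q, d, hp, hq, hd, hle⟩ := hsuper x₀ y₀ t₀ hxy₀ ht₀0 ht₀T (by
    have h3 : 0 < η * (1 + t₀) := by positivity
    simp only [hZ] at hpos
    linarith)
  have hspace := graphicalMCOperator_sub_le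
    ((hu.contDiff_slice ht₀0 ht₀T).of_le ENat.LEInfty.out)
    hM hxy₀ hp hq (fun x' y' => by
      have := hglob x' y' t₀ ht₀
      simp only [hZ] at this
      linarith)
  have htime : HasDerivAt (fun s => Z (x₀, y₀, s))
      (graphicalMCOperator (fun z => u z t₀) y₀ - graphicalMCOperator (fun z => u z t₀) x₀ -
        2 * M * (d * (1 / M ^ 2)) - η * 1) t₀ := by
    have h1 : HasDerivAt (fun s => ψ (‖y₀ - x₀‖ / (2 * M)) (s / M ^ 2)) (d * (1 / M ^ 2)) t₀ :=
      hd.comp t₀ ((hasDerivAt_id t₀).div_const (M ^ 2))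
    exact (((hu.hasDerivAt y₀ ht₀0 ht₀T).sub (hu.hasDerivAt x₀ ht₀0 ht₀T)).sub
      (h1.const_mul (2 * M))).sub (((hasDerivAt_id t₀).const_add 1).const_mul η)
  have hnn := htime.nonneg_of_eventually_le_left (by
    filter_upwards [Ioo_mem_nhdsLT hεt₀] with s hs
    exact hglob x₀ y₀ s ⟨hs.1.le, hs.2.le.trans ht₀.2⟩)
  have h1 : 2 * M * (d * (1 / M ^ 2)) = 2 / M * d := by field_simp
  have h2 : 2 / M * (q / (1 + p (‖y₀ - x₀‖ / (2 * M)) ^ 2)) ≤ 2 / M * d := by gcongr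
  linarith

end Flow

/-! ### The two estimates -/

theorem mainTheorem2 {n : ℕ} (Γ : Fin n → EuclideanSpace ℝ (Fin n))
    (hΓ : LinearIndependent ℝ Γ) (T : EReal) (u : EuclideanSpace ℝ (Fin n) → ℝ → ℝ)
    (hu : IsSmoothGraphicalMCF T u) (M : ℝ) (hM : 0 < M)
    (hosc : ∀ x y : EuclideanSpace ℝ (Fin n), |u x 0 - u y 0| ≤ M)
    (hper : ∀ t : ℝ, 0 ≤ t → (t : EReal) < T → IsGammaPeriodic Γ (fun x => u x t)) :
    (∀ φ : ℝ → ℝ → ℝ, IsStepCurveShortening φ →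
      ∀ (x y : EuclideanSpace ℝ (Fin n)) (t : ℝ), 0 < t → (t : EReal) < T →
        |u y t - u x t| ≤ 2 * M * φ (‖y - x‖ / (2 * M)) (t / M ^ 2)) ∧
    (∀ (x : EuclideanSpace ℝ (Fin n)) (t : ℝ), 0 < t → (t : EReal) < T →
        1 + ‖gradient (fun z => u z t) x‖ ^ 2 ≤ Real.exp (2 * M ^ 2 / t)) := by
  refine ⟨fun φ hφ x y t ht htT => ?_, fun x t ht htT => ?_⟩
  · have h : ∀ x y, u y t - u x t ≤ 2 * M * φ (‖y - x‖ / (2 * M)) (t / M ^ 2) := fun x y =>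
      hφ.isStepBarrier.sub_le hΓ hu hM hosc hper (fun x y s hxy hs _ _ =>
        hφ.isSupersolutionAt (div_pos (norm_sub_pos_iff.2 hxy.symm) (by positivity))
          (by positivity)) x y ht htT
    refine abs_sub_le_iff.2 ⟨h x y, ?_⟩
    rw [norm_sub_rev]
    exact h y x
  · -- The constant barrier shows that the oscillation does not increase.
    have hoscT : ∀ x y, ∀ s : ℝ, 0 < s → (s : EReal) < T → u y s - u x s ≤ M := by
      intro x y s hs hsT
      have := isStepBarrier_const.sub_le hΓ hu hM hosc hper
        (fun _ _ _ _ _ _ _ => isSupersolutionAt_const _ _ _) x y hs hsT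
      linarith
    have hτ : 0 < t / M ^ 2 := by positivity
    have hC := barrierSlope_pos hτ
    have h : ∀ x y, u y t - u x t ≤ barrierSlope (t / M ^ 2) * ‖y - x‖ := by
      intro x y
      have h1 := isStepBarrier_sineBarrier.sub_le hΓ hu hM hosc hper
        (fun x y s hxy hs hsT hlt => isSupersolutionAt_sineBarrier
          (div_pos (norm_sub_pos_iff.2 hxy.symm) (by positivity)) (by positivity) (by
            have := hlt.trans_le (hoscT x y s hs hsT)
            nlinarith)) x y ht htT
      -- The slope at the origin dominates the barrier, so `u(·, t)` is Lipschitz with constant `C`.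
      have h2 := sineBarrier_le (r := ‖y - x‖ / (2 * M)) (by positivity) hτ
      calc u y t - u x t ≤ _ := h1
        _ ≤ 2 * M * (barrierSlope (t / M ^ 2) * (‖y - x‖ / (2 * M))) := by gcongr
        _ = _ := by field_simp
    have hfd : ‖fderiv ℝ (fun z => u z t) x‖ ≤ barrierSlope (t / M ^ 2) := by
      refine norm_fderiv_le_of_lip' ℝ hC.le (Eventually.of_forall fun y => ?_)
      rw [Real.norm_eq_abs, abs_sub_le_iff]
      refine ⟨h x y, ?_⟩
      rw [norm_sub_rev]
      exact h y x
    have hg : ‖gradient (fun z => u z t) x‖ = ‖fderiv ℝ (fun z => u z t) x‖ := by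
      unfold gradient
      exact LinearIsometryEquiv.norm_map _ _
    calc 1 + ‖gradient (fun z => u z t) x‖ ^ 2 ≤ 1 + barrierSlope (t / M ^ 2) ^ 2 := by
          rw [hg]; gcongr
      _ = Real.exp (2 * M ^ 2 / t) := by
          rw [one_add_barrierSlope_sq hτ]
          congr 1
          field_simp
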